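/- For a complex matrix $A$ with $k$ rows and $n$ columns let $\|A\|=\sup_{0\ne x\in\mathbb C^n}\|Ax\|/\|x\|$ be its operator norm with respect to the Euclidean vector norms, and put $$\|A\|_\Delta=\max_{0\ne\xi\in\{0,1\}^n}\frac{\|A\xi\|}{\|\xi\|},\qquad \|A\|_P=\max_{0\ne\xi\in\{0,1\}^k,\ 0\ne\eta\in\{0,1\}^n}\frac{|\xi^tA\eta|}{\|\xi\|\,\|\eta\|}.$$ For an integer $m\ge1$ let $\Gamma_m$ be the graph with vertex set $\{0,1\}^m$ in which two vectors are adjacent if and only if their supports are disjoint (so the zero vector carries a loop, and there are no other loops), let $A_m$ be its adjacency matrix, and let $\varphi=(1+\sqrt5)/2$. For $X,Y\subseteq\{0,1\}^m$ let $N_X(v)$ be the set of neighbours of $v$ in $X$, and let $e(X,Y)$ be the number of pairs $(x,y)\in X\times Y$ such that $x$ and $y$ are adjacent in $\Gamma_m$. Then: (1) $\|A_m\|=\varphi^m$ for every $m\ge1$. (2) There is an absolute constant $C>0$ with $\|A_m\|_\Delta\le C\,\|A_m\|/m^{1/4}$ for every $m\ge1$. (3) There is an absolute constant $C>0$ with $\|A_m\|_P\le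 C\,\|A_m\|/\sqrt m$ for every $m\ge1$. (4) There is an absolute constant $C>0$ with $\sum_{v\in\{0,1\}^m}|N_X(v)|^2\le C\,\frac{\varphi^{2m}}{\sqrt m}\,|X|$ for every $m\ge1$ and every $X\subseteq\{0,1\}^m$ (the combinatorial form of (2)). (5) There is an absolute constant $C>0$ with $e(X,Y)\le C\,\frac{\varphi^m}{\sqrt m}\sqrt{|X||Y|}$ for every $m\ge1$ and all $X,Y\subseteq\{0,1\}^m$ (the combinatorial form of (3)). (6) Consequently, the logarithmic factors in the general lower bounds $\|A\|_\Delta\ge c\,\|A\|/\sqrt{\log h(A)+1}$ and $\|A\|_P\ge c\,\|A\|/(\log h(A)+1)$, where $h(A)=\sqrt{\|A\|_1\|A\|_\infty}/\|A\|$ with $\|A\|_1$ and $\|A\|_\infty$ the largest absolute column and row sums, cannot be dropped even for symmetric zero-one matrices: there is no absolute constant $c>0$ such that $\|A\|_\Delta\ge c\,\|A\|$ for the adjacency matrix $A$ of every finite simple graph with at least one edge, and there is no absolute constant $c>0$ such that $\|A\|_P\ge c\,\|A\|$ for all these matrices. -/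

import Mathlib

open scoped Matrix Matrix.Norms.L2Operator goldenRatio

/-- A non-zero vector all of whose coordinates are `0` or `1`. -/
def IsBinaryVec {n : Type*} (ξ : n → ℂ) : Prop :=
  ξ ≠ 0 ∧ ∀ i, ξ i = 0 ∨ ξ i = 1

/-- The usual Euclidean norm of a complex vector. -/
noncomputable def eucNorm {n : Type*} [Fintype n] (x : n → ℂ) : ℝ :=
  ‖WithLp.toLp 2 x‖

/-- The quotients `‖Aξ‖ / ‖ξ‖` over all non-zero binary vectors `ξ`. -/
def discreteQuotients {m n : Type*} [Fintype m] [Fintype n] (A : Matrix m n ℂ) : Set ℝ :=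
  {r | ∃ ξ : n → ℂ, IsBinaryVec ξ ∧ r = eucNorm (A *ᵥ ξ) / eucNorm ξ}

/-- The quotients `|ξᵗAη| / (‖ξ‖‖η‖)` over all pairs of non-zero binary vectors `ξ`, `η`. -/
def rayleighQuotients {m n : Type*} [Fintype m] [Fintype n] (A : Matrix m n ℂ) : Set ℝ :=
  {r | ∃ (ξ : m → ℂ) (η : n → ℂ), IsBinaryVec ξ ∧ IsBinaryVec η ∧
    r = ‖ξ ⬝ᵥ (A *ᵥ η)‖ / (eucNorm ξ * eucNorm η)}

/-- The discrete norm `‖A‖_Δ = max ‖Aξ‖ / ‖ξ‖` over non-zero binary `ξ`. -/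
noncomputable def discreteNorm {m n : Type*} [Fintype m] [Fintype n] (A : Matrix m n ℂ) : ℝ :=
  sSup (discreteQuotients A)

/-- The discrete Rayleigh norm `‖A‖_P = max |ξᵗAη| / (‖ξ‖‖η‖)` over non-zero binary `ξ`, `η`. -/
noncomputable def discreteRayleighNorm {m n : Type*} [Fintype m] [Fintype n]
    (A : Matrix m n ℂ) : ℝ :=
  sSup (rayleighQuotients A)

theorem finite_isBinaryVec (n : Type*) [Fintype n] : {ξ : n → ℂ | IsBinaryVec ξ}.Finite := by
  have h : (Set.pi Set.univ fun _ : n => ({0, 1} : Set ℂ)).Finite :=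
    Set.Finite.pi fun _ => (Set.finite_singleton (1 : ℂ)).insert 0
  exact h.subset fun ξ hξ i _ => by simpa using hξ.2 i

theorem isBinaryVec_one (n : Type*) [Nonempty n] : IsBinaryVec (1 : n → ℂ) :=
  ⟨one_ne_zero, fun _ => Or.inr rfl⟩

/-- The supremum in the definition of the discrete norm is a maximum. -/
theorem discreteNorm_isGreatest {m n : Type*} [Fintype m] [Fintype n] [Nonempty n]
    (A : Matrix m n ℂ) : IsGreatest (discreteQuotients A) (discreteNorm A) := by
  have hfin : (discreteQuotients A).Finite := by
    refine ((finite_isBinaryVec n).image fun ξ => eucNorm (A *ᵥ ξ) / eucNorm ξ).subset ?_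
    rintro r ⟨ξ, hξ, rfl⟩
    exact ⟨ξ, hξ, rfl⟩
  have hne : (discreteQuotients A).Nonempty := ⟨_, 1, isBinaryVec_one n, rfl⟩
  exact ⟨hne.csSup_mem hfin, fun r hr => le_csSup hfin.bddAbove hr⟩

/-- The supremum in the definition of the discrete Rayleigh norm is a maximum. -/
theorem discreteRayleighNorm_isGreatest {m n : Type*} [Fintype m] [Fintype n] [Nonempty m]
    [Nonempty n] (A : Matrix m n ℂ) :
    IsGreatest (rayleighQuotients A) (discreteRayleighNorm A) := by
  have hfin : (rayleighQuotients A).Finite := by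
    refine (((finite_isBinaryVec m).prod (finite_isBinaryVec n)).image fun p =>
      ‖p.1 ⬝ᵥ (A *ᵥ p.2)‖ / (eucNorm p.1 * eucNorm p.2)).subset ?_
    rintro r ⟨ξ, η, hξ, hη, rfl⟩
    exact ⟨(ξ, η), ⟨hξ, hη⟩, rfl⟩
  have hne : (rayleighQuotients A).Nonempty :=
    ⟨_, 1, 1, isBinaryVec_one m, isBinaryVec_one n, rfl⟩
  exact ⟨hne.csSup_mem hfin, fun r hr => le_csSup hfin.bddAbove hr⟩

/-- The vertex set `{0,1}^m`. -/
abbrev BinVec (m : ℕ) : Type := Fin m → Fin 2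

/-- Adjacency in the graph `Γ_m`: two binary vectors are adjacent iff their supports are disjoint.
The zero vector is adjacent to itself, so `Γ_m` has one loop and is not a `SimpleGraph`. -/
def GammaAdj (m : ℕ) (u v : BinVec m) : Prop :=
  Disjoint (Function.support u) (Function.support v)

open Classical in
/-- The adjacency matrix `A_m` of `Γ_m`. -/
noncomputable def gammaMatrix (m : ℕ) : Matrix (BinVec m) (BinVec m) ℂ :=
  Matrix.of fun u v => if GammaAdj m u v then 1 else 0

open Classical in
/-- `N_X(v)`: the set of neighbours of `v` in `X`, in the graph `Γ_m`. -/
noncomputable def gammaNbrs {m : ℕ} (X : Finset (BinVec m)) (v : BinVec m) :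
    Finset (BinVec m) :=
  {u ∈ X | GammaAdj m u v}

open Classical in
/-- `e(X,Y)`: the number of pairs `(x,y) ∈ X × Y` with `x` and `y` adjacent in `Γ_m`. -/
noncomputable def gammaEdges {m : ℕ} (X Y : Finset (BinVec m)) : ℕ :=
  ({p ∈ X ×ˢ Y | GammaAdj m p.1 p.2} : Finset (BinVec m × BinVec m)).card

/-!
The matrix `A_m` is the `m`-th tensor power of `[[1, 1], [1, 0]]`, and `φ ^ (-|x|)` is a positive
eigenvector with eigenvalue `φ ^ m` (`sum_gammaInd_mul_inv_pow`). Schur's test with this vector gives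
the operator norm (`norm_gammaMatrix`).

The eigenvector spreads its `ℓ²` mass over about `√m` levels `|x| = k`, while it varies
exponentially from one level to the next; an indicator function can resemble it only on boundedly
many levels. In quantitative form: from a vertex `x`, the part of the Schur sum that lies on one
level `|y| = l` is an atom of a binomial law with `m - |x|` trials and success probability `φ⁻²`.
Hence it is only `O(1 / √m)` of the whole, unless `|x|` is close to `m`
(`choose_le_goldenRatio_pow`). The lemma `sum_sum_le_of_fiber_le` turns such bounds for single levels
into a bound for sums over `X × Y`: divide the pairs by whether `φ ^ (|y| - |x|)` is at most
`√(|Y| / |X|)`; sum one half along rows and the other along columns; each such sum is a geometric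
series dominated by one level. This gives the bound on `e(X, Y)` (`sum_gammaInd_le`); vertices with
`|x| ≥ 2m / 3` have too few neighbours to matter (`sum_gammaInd_le_of_large`).

The sum of `|N_X(v)|²` is the same kind of sum over `X × X` with kernel `A_m²`. Its sums over levels
are averages of binomial atoms with a random number of trials, and they are `O(1 / √m)` for all `x`
(`sum_choose_mul_choose_le`), with no exceptional vertices.

The discrete norms are these estimates for indicator vectors. They use only that the matrix is
dominated entrywise by `A_m`, so they hold after the loop at `0` is removed, while the operator norm
drops by at most `1`. This yields the simple graphs that exclude a uniform constant.
-/

open scoped Matrix Matrix.Norms.L2Operator goldenRatio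

/-! ### The largest atom of a binomial law -/

/-- The central binomial coefficient is at most `4 ^ j / √(2j + 1)`; the induction closes because
`(2j + 1)(2j + 3) ≤ 4(j + 1)²`. -/
theorem centralBinom_sq_mul_le (j : ℕ) : j.centralBinom ^ 2 * (2 * j + 1) ≤ 4 ^ (2 * j) := by
  induction j with
  | zero => simp
  | succ j ih =>
    have h := Nat.succ_mul_centralBinom_succ j
    have h2 : (j + 1) ^ 2 * ((j + 1).centralBinom ^ 2 * (2 * (j + 1) + 1)) ≤
        (j + 1) ^ 2 * 4 ^ (2 * (j + 1)) := by
      calc (j + 1) ^ 2 * ((j + 1).centralBinom ^ 2 * (2 * (j + 1) + 1))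
          = ((j + 1) * (j + 1).centralBinom) ^ 2 * (2 * j + 3) := by ring
        _ = 4 * ((2 * j + 1) * (2 * j + 3)) * (j.centralBinom ^ 2 * (2 * j + 1)) := by
            rw [h]; ring
        _ ≤ 4 * (4 * (j + 1) ^ 2) * 4 ^ (2 * j) := by
            refine Nat.mul_le_mul (Nat.mul_le_mul_left 4 ?_) ih
            nlinarith
        _ = (j + 1) ^ 2 * 4 ^ (2 * (j + 1)) := by ring
    exact Nat.le_of_mul_le_mul_left h2 (by positivity)

theorem choose_sq_mul_succ_le (N l : ℕ) : N.choose l ^ 2 * (N + 1) ≤ 4 ^ N := by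
  refine le_trans (Nat.mul_le_mul_right _ (Nat.pow_le_pow_left (Nat.choose_le_middle l N) 2)) ?_
  rcases Nat.even_or_odd' N with ⟨j, rfl | rfl⟩
  · have := centralBinom_sq_mul_le j
    rw [Nat.centralBinom_eq_two_mul_choose] at this
    simpa using this
  · have h1 : (j + 1).centralBinom = 2 * (2 * j + 1).choose j := by
      rw [Nat.centralBinom_eq_two_mul_choose, show 2 * (j + 1) = 2 * j + 1 + 1 by ring,
        Nat.choose_succ_succ, ← Nat.choose_symm_half j]
      ring
    have h2 := centralBinom_sq_mul_le (j + 1)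
    rw [h1] at h2
    have h3 : (2 * j + 1) / 2 = j := by omega
    rw [h3]
    have h4 : (4 : ℕ) ^ (2 * (j + 1)) = 4 * 4 ^ (2 * j + 1) := by ring
    rw [h4] at h2
    nlinarith

theorem choose_le_two_pow_div_sqrt (N l : ℕ) : (N.choose l : ℝ) ≤ 2 ^ N / √(N + 1) := by
  rw [le_div_iff₀ (by positivity)]
  refine (pow_le_pow_iff_left₀ (by positivity) (by positivity) two_ne_zero).1 ?_
  rw [mul_pow, Real.sq_sqrt (by positivity), ← pow_mul, mul_comm N, pow_mul]
  norm_num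
  exact_mod_cast choose_sq_mul_succ_le N l

/-- The mean of `1 / (N + 1)` for a binomial variable `N`, computed from
`C(n, i) / (i + 1) = C(n + 1, i + 1) / (n + 1)`. -/
theorem sum_choose_mul_div_succ_le {a b : ℝ} (ha : 0 < a) (hb : 0 ≤ b) (n : ℕ) :
    ∑ i ∈ Finset.range (n + 1), (n.choose i : ℝ) * a ^ i * b ^ (n - i) / (i + 1) ≤
      (a + b) ^ (n + 1) / (a * (n + 1)) := by
  rw [le_div_iff₀ (by positivity), Finset.sum_mul, add_pow,
    Finset.sum_range_succ' _ (n + 1)]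
  have h0 : 0 ≤ a ^ 0 * b ^ (n + 1 - 0) * ((n + 1).choose 0 : ℝ) := by positivity
  refine le_trans (Finset.sum_le_sum fun i _ => ?_) (le_add_of_nonneg_right h0)
  have h : ((n + 1).choose (i + 1) : ℝ) * (i + 1) = (n + 1) * n.choose i := by
    exact_mod_cast (Nat.add_one_mul_choose_eq n i).symm
  rw [Nat.add_sub_add_right, div_mul_eq_mul_div, div_le_iff₀ (by positivity)]
  apply le_of_eq
  linear_combination (-(a ^ (i + 1) * b ^ (n - i))) * h

/-- A mean of `1 / √Z` for a binomial variable: if `Z i` is at least the proportion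
`(i + 1) / (n + 1)` of `M`, then the mean is `O(1 / √M)`. -/
theorem sum_choose_mul_div_sqrt_le {a b M : ℝ} (ha : 0 < a) (hb : 0 ≤ b) (hM : 0 < M) (n : ℕ)
    (Z : ℕ → ℝ) (hZ : ∀ i ≤ n, M * (i + 1) / (n + 1) ≤ Z i) :
    ∑ i ∈ Finset.range (n + 1), (n.choose i : ℝ) * a ^ i * b ^ (n - i) / √(Z i) ≤
      ((a + b) / a + 1) / 2 * ((a + b) ^ n / √M) := by
  have hs : 0 < √M := Real.sqrt_pos.2 hM
  have hss : √M * √M = M := Real.mul_self_sqrt hM.le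
  calc ∑ i ∈ Finset.range (n + 1), (n.choose i : ℝ) * a ^ i * b ^ (n - i) / √(Z i)
      ≤ ∑ i ∈ Finset.range (n + 1), ((n + 1) / (2 * √M) *
          ((n.choose i : ℝ) * a ^ i * b ^ (n - i) / (i + 1)) +
          1 / (2 * √M) * (a ^ i * b ^ (n - i) * n.choose i)) := by
        refine Finset.sum_le_sum fun i hi => ?_
        have hz := hZ i (by simpa [Nat.lt_succ_iff] using hi)
        have hz0 : 0 < M * (i + 1) / ((n : ℝ) + 1) := by positivity
        have key : 1 / √(Z i) ≤ (n + 1) / (2 * √M * (i + 1)) + 1 / (2 * √M) := by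
          refine (one_div_le_one_div_of_le (Real.sqrt_pos.2 hz0) (Real.sqrt_le_sqrt hz)).trans ?_
          -- AM-GM for the numbers `(n + 1) / (i + 1)` and `1`
          have hr : √(M * (i + 1) / ((n : ℝ) + 1)) = √M * √((i + 1) / ((n : ℝ) + 1)) := by
            rw [mul_div_assoc, Real.sqrt_mul hM.le]
          set r := √((i + 1) / ((n : ℝ) + 1)) with hrd
          have hr0 : 0 < r := Real.sqrt_pos.2 (by positivity)
          have hr2 : r ^ 2 = (i + 1) / ((n : ℝ) + 1) := Real.sq_sqrt (by positivity)
          have h1 : ((n : ℝ) + 1) / (2 * √M * (i + 1)) = 1 / (2 * √M * r ^ 2) := by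
            rw [hr2]; field_simp
          rw [hr, h1, div_add_div _ _ (by positivity) (by positivity),
            div_le_div_iff₀ (by positivity) (by positivity)]
          have : 0 ≤ 2 * √M * √M * r * (r - 1) ^ 2 := by positivity
          nlinarith
        calc (n.choose i : ℝ) * a ^ i * b ^ (n - i) / √(Z i)
            = (n.choose i : ℝ) * a ^ i * b ^ (n - i) * (1 / √(Z i)) := by ring
          _ ≤ (n.choose i : ℝ) * a ^ i * b ^ (n - i) *
              ((n + 1) / (2 * √M * (i + 1)) + 1 / (2 * √M)) := by gcongr
          _ = _ := by field_simp
    _ = (n + 1) / (2 * √M) * (∑ i ∈ Finset.range (n + 1),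
          (n.choose i : ℝ) * a ^ i * b ^ (n - i) / (i + 1)) + 1 / (2 * √M) * (a + b) ^ n := by
        rw [Finset.sum_add_distrib, ← Finset.mul_sum, ← Finset.mul_sum, add_pow]
    _ ≤ (n + 1) / (2 * √M) * ((a + b) ^ (n + 1) / (a * (n + 1))) +
          1 / (2 * √M) * (a + b) ^ n := by
        gcongr
        exact sum_choose_mul_div_succ_le ha hb n
    _ = _ := by field_simp; ring

/-- Thinning: the coefficients of `(1 + t X) ^ n = (t (1 + X) + (1 - t)) ^ n`. For `0 ≤ t ≤ 1` it
writes a skew binomial law as a mixture of symmetric ones, so that only the symmetric one needs an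
estimate of its largest atom. -/
theorem choose_mul_pow_eq_sum (t : ℝ) (n l : ℕ) :
    (n.choose l : ℝ) * t ^ l =
      ∑ N ∈ Finset.range (n + 1), (n.choose N : ℝ) * t ^ N * (1 - t) ^ (n - N) * N.choose l := by
  open Polynomial in
  have h : ((1 + X : ℝ[X]) ^ n).comp (C t * X) = (C t * (1 + X) + C (1 - t)) ^ n := by
    simp only [pow_comp, add_comp, one_comp, X_comp, C_sub, C_1]
    ring
  have h2 := congrArg (fun p => Polynomial.coeff p l) h
  simp only [Polynomial.comp_C_mul_X_coeff, Polynomial.coeff_one_add_X_pow] at h2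
  rw [h2, add_pow, Polynomial.finsetSum_coeff]
  refine Finset.sum_congr rfl fun N _ => ?_
  rw [mul_pow, ← Polynomial.C_pow, ← Polynomial.C_pow, ← Polynomial.C_eq_natCast, mul_right_comm,
    mul_right_comm, Polynomial.coeff_mul_C, Polynomial.coeff_mul_C, Polynomial.coeff_C_mul,
    Polynomial.coeff_one_add_X_pow]
  ring

/-- The binomial law with success probability `φ⁻²` has all its atoms `O(1 / √n)`. The factor
`φ ^ (n + l)` is the reciprocal of the weight of a point with `l` successes, since
`1 - φ⁻² = φ⁻¹`. -/
theorem choose_le_goldenRatio_pow (n l : ℕ) :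
    (n.choose l : ℝ) ≤ 2 * (φ ^ (n + l) / √(n + 1)) := by
  have hφ := Real.goldenRatio_pos
  have hφ1 := Real.one_lt_goldenRatio
  have hφ2 := Real.goldenRatio_sq
  have hlt : φ < 2 := Real.goldenRatio_lt_two
  have hi : φ⁻¹ = φ - 1 := inv_eq_of_mul_eq_one_right (by linear_combination hφ2)
  have hS : 2 * φ⁻¹ + (1 - φ⁻¹) = φ := by rw [hi]; ring
  have hb : 0 ≤ 1 - φ⁻¹ := by rw [hi]; linarith
  have key : (n.choose l : ℝ) * φ⁻¹ ^ l ≤ 2 * (φ ^ n / √(n + 1)) := by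
    rw [choose_mul_pow_eq_sum]
    have h := sum_choose_mul_div_sqrt_le (a := 2 * φ⁻¹) (b := 1 - φ⁻¹) (M := n + 1)
      (by positivity) hb (by positivity) n (fun i => i + 1) (fun i _ => by
        rw [mul_div_assoc, mul_comm, div_mul_cancel₀]; positivity)
    rw [hS] at h
    refine le_trans (Finset.sum_le_sum fun N _ => ?_) (h.trans ?_)
    · calc (n.choose N : ℝ) * φ⁻¹ ^ N * (1 - φ⁻¹) ^ (n - N) * N.choose l
          ≤ (n.choose N : ℝ) * φ⁻¹ ^ N * (1 - φ⁻¹) ^ (n - N) * (2 ^ N / √(N + 1)) := by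
            gcongr
            exact choose_le_two_pow_div_sqrt N l
        _ = _ := by rw [mul_pow]; ring
    · gcongr
      rw [div_mul_eq_div_div]
      have : φ / 2 / φ⁻¹ = φ ^ 2 / 2 := by field_simp
      rw [this, hφ2]
      linarith
  rw [inv_pow, ← div_eq_mul_inv, div_le_iff₀ (by positivity)] at key
  refine key.trans (le_of_eq ?_)
  rw [pow_add]; ring

/-! ### Sums of graded kernels over product sets -/

/-- A sum of distinct powers of `r > 1` is comparable with the largest of them. -/
theorem sum_pow_le_of_forall_pow_le {r T : ℝ} (hr : 1 < r) (hT : 0 ≤ T) (S : Finset ℕ)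
    (hS : ∀ l ∈ S, r ^ l ≤ T) : ∑ l ∈ S, r ^ l ≤ r / (r - 1) * T := by
  have hr0 : 0 < r - 1 := by linarith
  rcases S.eq_empty_or_nonempty with rfl | hne
  · simp; positivity
  · have hsub : S ⊆ Finset.range (S.max' hne + 1) := fun l hl =>
      Finset.mem_range.2 (Nat.lt_succ_of_le (S.le_max' l hl))
    calc ∑ l ∈ S, r ^ l ≤ ∑ l ∈ Finset.range (S.max' hne + 1), r ^ l :=
          Finset.sum_le_sum_of_subset_of_nonneg hsub fun _ _ _ => by positivity
      _ = (r ^ (S.max' hne + 1) - 1) / (r - 1) := geom_sum_eq hr.ne' _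
      _ ≤ (r * r ^ (S.max' hne)) / (r - 1) := by
          gcongr
          rw [pow_succ]; linarith
      _ ≤ (r * T) / (r - 1) := by
          gcongr
          exact hS _ (S.max'_mem hne)
      _ = _ := by ring

/-- Half of `sum_sum_le_of_fiber_le`: in the row of `x`, the levels `l` with `r ^ l ≤ θ * r ^ wV x`
contribute a geometric series dominated by its largest term. -/
theorem sum_filter_pow_le {V W : Type*} {K : V → W → ℝ} (hK : ∀ x y, 0 ≤ K x y) (wV : V → ℕ)
    (wW : W → ℕ) {r D θ : ℝ} (hr : 1 < r) (hD : 0 ≤ D) (hθ : 0 ≤ θ) (Y : Finset W) (x : V)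
    (h : ∀ l, ∑ y ∈ Y with wW y = l, K x y ≤ D * (r ^ l / r ^ wV x)) :
    ∑ y ∈ Y with r ^ wW y ≤ θ * r ^ wV x, K x y ≤ r / (r - 1) * D * θ := by
  have hr0 : 0 < r := by linarith
  have hr1 : 0 < r - 1 := by linarith
  set F := Y.filter fun y => r ^ wW y ≤ θ * r ^ wV x with hF
  calc ∑ y ∈ F, K x y = ∑ l ∈ F.image wW, ∑ y ∈ F with wW y = l, K x y :=
        (Finset.sum_fiberwise_of_maps_to (fun y hy => Finset.mem_image_of_mem _ hy) _).symm
    _ ≤ ∑ l ∈ F.image wW, D / r ^ wV x * r ^ l := by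
        refine Finset.sum_le_sum fun l _ => ?_
        refine (Finset.sum_le_sum_of_subset_of_nonneg ?_ fun _ _ _ => hK _ _).trans
          ((h l).trans (le_of_eq (by ring)))
        exact Finset.filter_subset_filter _ (Finset.filter_subset _ _)
    _ = D / r ^ wV x * ∑ l ∈ F.image wW, r ^ l := by rw [Finset.mul_sum]
    _ ≤ D / r ^ wV x * (r / (r - 1) * (θ * r ^ wV x)) := by
        gcongr
        refine sum_pow_le_of_forall_pow_le hr (by positivity) _ fun l hl => ?_
        obtain ⟨y, hy, rfl⟩ := Finset.mem_image.1 hl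
        exact (Finset.mem_filter.1 hy).2
    _ = _ := by field_simp

/-- A restricted weak type estimate. Let `wV`, `wW` grade the two sides of a nonnegative kernel. If
each row sum over the level `l` is at most `D * r ^ (l - wV x)`, and likewise for the columns, then
the sum over `X × Y` is `O(D √(|X||Y|))`. The Schur test with weights `r ^ (-w)` would have to sum
these bounds over all levels; for indicator functions the exponential weights make a single level
dominate. -/
theorem sum_sum_le_of_fiber_le {V W : Type*} {K : V → W → ℝ} (hK : ∀ x y, 0 ≤ K x y)
    (wV : V → ℕ) (wW : W → ℕ) {r D : ℝ} (hr : 1 < r) (hD : 0 ≤ D) (X : Finset V) (Y : Finset W)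
    (hX : ∀ x ∈ X, ∀ l, ∑ y ∈ Y with wW y = l, K x y ≤ D * (r ^ l / r ^ wV x))
    (hY : ∀ y ∈ Y, ∀ k, ∑ x ∈ X with wV x = k, K x y ≤ D * (r ^ k / r ^ wW y)) :
    ∑ x ∈ X, ∑ y ∈ Y, K x y ≤ 2 * (r / (r - 1)) * D * √((X.card : ℝ) * Y.card) := by
  have hr0 : 0 < r := by linarith
  rcases X.eq_empty_or_nonempty with rfl | hXne
  · simp
  rcases Y.eq_empty_or_nonempty with rfl | hYne
  · simp
  have hx : (0 : ℝ) < X.card := by exact_mod_cast hXne.card_pos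
  have hy : (0 : ℝ) < Y.card := by exact_mod_cast hYne.card_pos
  -- this threshold makes the two halves of the sum have equal bounds
  set θ : ℝ := √(Y.card : ℝ) / √(X.card : ℝ) with hθ
  have hθ0 : 0 < θ := by positivity
  have hxx : √(X.card : ℝ) * √(X.card : ℝ) = X.card := Real.mul_self_sqrt hx.le
  have hyy : √(Y.card : ℝ) * √(Y.card : ℝ) = Y.card := Real.mul_self_sqrt hy.le
  have e1 : X.card * θ = √((X.card : ℝ) * Y.card) := by
    rw [Real.sqrt_mul hx.le, hθ]; nth_rw 1 [← hxx]; field_simp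
  have e2 : Y.card * θ⁻¹ = √((X.card : ℝ) * Y.card) := by
    rw [Real.sqrt_mul hx.le, hθ]; nth_rw 1 [← hyy]; field_simp
  have h1 : ∑ x ∈ X, ∑ y ∈ Y with r ^ wW y ≤ θ * r ^ wV x, K x y ≤
      r / (r - 1) * D * √((X.card : ℝ) * Y.card) := by
    refine (Finset.sum_le_sum fun x hx => sum_filter_pow_le hK wV wW hr hD hθ0.le Y x
      (hX x hx)).trans (le_of_eq ?_)
    rw [Finset.sum_const, nsmul_eq_mul, ← e1]; ring
  have h2 : ∑ x ∈ X, ∑ y ∈ Y with ¬ r ^ wW y ≤ θ * r ^ wV x, K x y ≤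
      r / (r - 1) * D * √((X.card : ℝ) * Y.card) := by
    calc ∑ x ∈ X, ∑ y ∈ Y with ¬ r ^ wW y ≤ θ * r ^ wV x, K x y
        ≤ ∑ x ∈ X, ∑ y ∈ Y with r ^ wV x ≤ θ⁻¹ * r ^ wW y, K x y := by
          refine Finset.sum_le_sum fun x _ => Finset.sum_le_sum_of_subset_of_nonneg ?_
            fun _ _ _ => hK _ _
          refine Finset.monotone_filter_right _ fun y _ hy => ?_
          rw [inv_mul_eq_div, le_div_iff₀ hθ0, mul_comm]
          exact (not_le.1 hy).le
      _ = ∑ y ∈ Y, ∑ x ∈ X with r ^ wV x ≤ θ⁻¹ * r ^ wW y, K x y := by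
          simp only [Finset.sum_filter]
          exact Finset.sum_comm
      _ ≤ ∑ y ∈ Y, r / (r - 1) * D * θ⁻¹ :=
          Finset.sum_le_sum fun y hy => sum_filter_pow_le (K := fun y x => K x y)
            (fun _ _ => hK _ _) wW wV hr hD (inv_nonneg.2 hθ0.le) X y (hY y hy)
      _ = _ := by rw [Finset.sum_const, nsmul_eq_mul, ← e2]; ring
  calc ∑ x ∈ X, ∑ y ∈ Y, K x y
      = (∑ x ∈ X, ∑ y ∈ Y with r ^ wW y ≤ θ * r ^ wV x, K x y) +
        ∑ x ∈ X, ∑ y ∈ Y with ¬ r ^ wW y ≤ θ * r ^ wV x, K x y := by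
        rw [← Finset.sum_add_distrib]
        exact Finset.sum_congr rfl fun x _ => (Finset.sum_filter_add_sum_filter_not _ _ _).symm
    _ ≤ _ := by linarith

/-! ### Neighbours in the disjointness graph by weight -/

/-- The support of a binary vector, as a finite set of coordinates. -/
def binSupp {m : ℕ} (x : BinVec m) : Finset (Fin m) := {i | x i ≠ 0}

/-- The Hamming weight of a binary vector. -/
def binWt {m : ℕ} (x : BinVec m) : ℕ := (binSupp x).card

theorem binWt_le {m : ℕ} (x : BinVec m) : binWt x ≤ m := by
  simpa [binWt] using Finset.card_le_univ (binSupp x)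

/-- Binary vectors correspond to subsets of the coordinates through their supports. -/
def binEquiv (m : ℕ) : BinVec m ≃ Finset (Fin m) where
  toFun := binSupp
  invFun s i := if i ∈ s then 1 else 0
  left_inv x := by
    funext i
    simp only [binSupp, Finset.mem_filter, Finset.mem_univ, true_and]
    split_ifs <;> omega
  right_inv s := by
    ext i
    simp [binSupp]

theorem gammaAdj_iff {m : ℕ} {x y : BinVec m} :
    GammaAdj m x y ↔ binSupp y ∈ (binSupp x)ᶜ.powerset := by
  rw [GammaAdj, Finset.mem_powerset, Set.disjoint_left]
  simp only [Finset.subset_iff, binSupp, Finset.mem_compl, Finset.mem_filter, Finset.mem_univ,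
    true_and, Function.mem_support]
  exact forall_congr' fun i => by tauto

theorem gammaAdj_comm {m : ℕ} {x y : BinVec m} : GammaAdj m x y ↔ GammaAdj m y x :=
  disjoint_comm

open Classical in
/-- The entries of the adjacency matrix of `Γ_m`, as real numbers. -/
noncomputable def gammaInd {m : ℕ} (x y : BinVec m) : ℝ := if GammaAdj m x y then 1 else 0

theorem gammaInd_nonneg {m : ℕ} (x y : BinVec m) : 0 ≤ gammaInd x y := by
  unfold gammaInd; split_ifs <;> norm_num

theorem gammaInd_comm {m : ℕ} (x y : BinVec m) : gammaInd x y = gammaInd y x := by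
  classical exact if_congr gammaAdj_comm rfl rfl

theorem sum_gammaInd_mul {m : ℕ} (x : BinVec m) (f : ℕ → ℝ) :
    ∑ y, gammaInd x y * f (binWt y) =
      ∑ j ∈ Finset.range (m - binWt x + 1), ((m - binWt x).choose j : ℝ) * f j := by
  classical
  have hc : ((binSupp x)ᶜ).card = m - binWt x := by
    rw [Finset.card_compl, Fintype.card_fin, binWt]
  have h := Finset.sum_powerset_apply_card f (x := (binSupp x)ᶜ)
  rw [hc] at h
  simp only [nsmul_eq_mul] at h
  rw [← h]
  calc ∑ y, gammaInd x y * f (binWt y)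
      = ∑ y, if binEquiv m y ∈ (binSupp x)ᶜ.powerset then f (binEquiv m y).card else 0 := by
        refine Finset.sum_congr rfl fun y _ => ?_
        have : binEquiv m y ∈ (binSupp x)ᶜ.powerset ↔ GammaAdj m x y := gammaAdj_iff.symm
        simp only [this, gammaInd, ite_mul, one_mul, zero_mul]
        rfl
    _ = ∑ s, if s ∈ (binSupp x)ᶜ.powerset then f s.card else 0 :=
        (binEquiv m).sum_comp fun s => if s ∈ (binSupp x)ᶜ.powerset then f s.card else 0
    _ = _ := by rw [Finset.sum_ite_mem, Finset.univ_inter]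

theorem sum_gammaInd_eq {m : ℕ} (x : BinVec m) :
    ∑ y, gammaInd x y = 2 ^ (m - binWt x) := by
  have h := sum_gammaInd_mul x fun _ => 1
  simp only [mul_one] at h
  rw [h]
  exact_mod_cast Nat.sum_range_choose _

/-- The weights `φ⁻¹ ^ |x|` form a positive eigenvector with eigenvalue `φ ^ m`. -/
theorem sum_gammaInd_mul_inv_pow {m : ℕ} (x : BinVec m) :
    ∑ y, gammaInd x y * φ⁻¹ ^ binWt y = φ ^ m * φ⁻¹ ^ binWt x := by
  have hi : φ⁻¹ = φ - 1 :=
    inv_eq_of_mul_eq_one_right (by linear_combination Real.goldenRatio_sq)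
  have h := add_pow φ⁻¹ 1 (m - binWt x)
  rw [show φ⁻¹ + 1 = φ by rw [hi]; ring] at h
  rw [sum_gammaInd_mul x fun j => φ⁻¹ ^ j, inv_pow, ← pow_sub₀ _ Real.goldenRatio_ne_zero
    (binWt_le x), h]
  exact Finset.sum_congr rfl fun j _ => by rw [one_pow]; ring

theorem sum_fiber_gammaInd_le {m : ℕ} (Y : Finset (BinVec m)) (x : BinVec m) (l : ℕ) :
    ∑ y ∈ Y with binWt y = l, gammaInd x y ≤ (m - binWt x).choose l := by
  calc ∑ y ∈ Y with binWt y = l, gammaInd x y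
      = ∑ y ∈ Y, gammaInd x y * if binWt y = l then 1 else 0 := by
        rw [Finset.sum_filter]
        exact Finset.sum_congr rfl fun y _ => by split_ifs <;> simp
    _ ≤ ∑ y, gammaInd x y * if binWt y = l then 1 else 0 :=
        Finset.sum_le_sum_of_subset_of_nonneg (Finset.subset_univ _) fun y _ _ =>
          mul_nonneg (gammaInd_nonneg _ _) (by split_ifs <;> norm_num)
    _ = ∑ j ∈ Finset.range (m - binWt x + 1),
          ((m - binWt x).choose j : ℝ) * if j = l then 1 else 0 :=
        sum_gammaInd_mul x fun j => if j = l then 1 else 0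
    _ ≤ (m - binWt x).choose l := by
        simp only [mul_ite, mul_one, mul_zero, Finset.sum_ite_eq']
        split_ifs
        · exact le_rfl
        · positivity

/-! ### Edges and walks of length two between vertex sets -/

theorem goldenRatio_gt : 1.6 < φ := by
  have := Real.goldenRatio_sq
  have := Real.goldenRatio_pos
  nlinarith

/-- Since `2 ^ (4 / 3) < 2.52 < 2.6 < φ ^ 2`, the right side wins by an exponential factor, which
Bernoulli's inequality compares with `m`. -/
theorem mul_two_pow_le (m : ℕ) : (m : ℝ) * (2 ^ (m / 3) * 2 ^ m) ≤ 36 * (φ ^ m) ^ 2 := by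
  have h1 : (2 : ℝ) ^ (m / 3) * 2 ^ m ≤ 2.52 ^ m := by
    refine (pow_le_pow_iff_left₀ (by positivity) (by positivity) three_ne_zero).1 ?_
    calc ((2 : ℝ) ^ (m / 3) * 2 ^ m) ^ 3 = 2 ^ (3 * (m / 3) + 3 * m) := by
          rw [← pow_add, ← pow_mul]; ring_nf
      _ ≤ 2 ^ (4 * m) := pow_le_pow_right₀ (by norm_num) (by omega)
      _ = (2 ^ 4) ^ m := pow_mul _ _ _
      _ ≤ (2.52 ^ 3) ^ m := by gcongr; norm_num
      _ = (2.52 ^ m) ^ 3 := by rw [← pow_mul, ← pow_mul, mul_comm]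
  have h2 : (m : ℝ) ≤ 36 * (2.6 / 2.52) ^ m := by
    have := one_add_mul_le_pow (a := (2.6 / 2.52 - 1 : ℝ)) (by norm_num) m
    rw [add_sub_cancel] at this
    have h0 : (0 : ℝ) ≤ m := m.cast_nonneg
    norm_num at this ⊢
    linarith
  calc (m : ℝ) * (2 ^ (m / 3) * 2 ^ m) ≤ 36 * (2.6 / 2.52) ^ m * 2.52 ^ m := by gcongr
    _ = 36 * 2.6 ^ m := by rw [mul_assoc, ← mul_pow]; norm_num
    _ ≤ 36 * (φ ^ 2) ^ m := by
        gcongr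
        rw [Real.goldenRatio_sq]
        linarith [goldenRatio_gt]
    _ = _ := by rw [← pow_mul, ← pow_mul, mul_comm m]

/-- Vectors of weight at least `2m / 3` have so few neighbours, at most `2 ^ (m / 3)`, that the
trivial count of edges is enough. For them `choose_le_goldenRatio_pow` gives no factor `1 / √m`. -/
theorem sum_gammaInd_le_of_large {m : ℕ} (hm : 1 ≤ m) (X Y : Finset (BinVec m))
    (hX : ∀ x ∈ X, 3 * (m - binWt x) ≤ m) :
    ∑ x ∈ X, ∑ y ∈ Y, gammaInd x y ≤ 6 * (φ ^ m / √m) * √((X.card : ℝ) * Y.card) := by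
  have hm0 : (0 : ℝ) < m := by exact_mod_cast hm
  set S := ∑ x ∈ X, ∑ y ∈ Y, gammaInd x y with hS
  have hS0 : 0 ≤ S := Finset.sum_nonneg fun _ _ => Finset.sum_nonneg fun _ _ => gammaInd_nonneg _ _
  have row (Z : Finset (BinVec m)) (x : BinVec m) : ∑ y ∈ Z, gammaInd x y ≤ 2 ^ (m - binWt x) := by
    rw [← sum_gammaInd_eq]
    exact Finset.sum_le_sum_of_subset_of_nonneg (Finset.subset_univ _)
      fun _ _ _ => gammaInd_nonneg _ _
  have h1 : S ≤ X.card * 2 ^ (m / 3) := by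
    rw [← nsmul_eq_mul]
    refine Finset.sum_le_card_nsmul _ _ _ fun x hx => (row Y x).trans ?_
    exact pow_le_pow_right₀ (by norm_num) (by have := hX x hx; omega)
  have h2 : S ≤ Y.card * 2 ^ m := by
    rw [← nsmul_eq_mul, hS, Finset.sum_comm]
    refine Finset.sum_le_card_nsmul _ _ _ fun y _ => ?_
    simp only [fun x => gammaInd_comm x y]
    exact (row X y).trans (pow_le_pow_right₀ (by norm_num) (Nat.sub_le _ _))
  refine (pow_le_pow_iff_left₀ hS0 (by have := Real.goldenRatio_pos; positivity) two_ne_zero).1 ?_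
  rw [mul_pow, mul_pow, Real.sq_sqrt (by positivity), div_pow, Real.sq_sqrt hm0.le]
  have h3 : (2 : ℝ) ^ (m / 3) * 2 ^ m ≤ 36 * (φ ^ m) ^ 2 / m := by
    rw [le_div_iff₀ hm0, mul_comm]; exact mul_two_pow_le m
  calc S ^ 2 ≤ (X.card * 2 ^ (m / 3)) * (Y.card * 2 ^ m) := by rw [sq]; gcongr
    _ = (2 ^ (m / 3) * 2 ^ m) * ((X.card : ℝ) * Y.card) := by ring
    _ ≤ 36 * (φ ^ m) ^ 2 / m * ((X.card : ℝ) * Y.card) := by gcongr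
    _ = _ := by ring

theorem sum_gammaInd_le_of_small {m : ℕ} (hm : 1 ≤ m) (X Y : Finset (BinVec m))
    (hX : ∀ x ∈ X, m < 3 * (m - binWt x)) (hY : ∀ y ∈ Y, m < 3 * (m - binWt y)) :
    ∑ x ∈ X, ∑ y ∈ Y, gammaInd x y ≤
      2 * (φ / (φ - 1)) * (4 * (φ ^ m / √m)) * √((X.card : ℝ) * Y.card) := by
  have hφ := Real.goldenRatio_pos
  have hm0 : (0 : ℝ) < m := by exact_mod_cast hm
  have key (Z : Finset (BinVec m)) (x : BinVec m) (hx : m < 3 * (m - binWt x)) (l : ℕ) :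
      ∑ y ∈ Z with binWt y = l, gammaInd x y ≤ 4 * (φ ^ m / √m) * (φ ^ l / φ ^ binWt x) := by
    refine (sum_fiber_gammaInd_le Z x l).trans ((choose_le_goldenRatio_pow _ l).trans ?_)
    have hs : √(m : ℝ) / 2 ≤ √(((m - binWt x : ℕ) : ℝ) + 1) := by
      refine Real.le_sqrt_of_sq_le ?_
      rw [div_pow, Real.sq_sqrt hm0.le]
      have : (m : ℝ) ≤ 3 * ((m - binWt x : ℕ) : ℝ) := by exact_mod_cast hx.le
      linarith
    have hs0 : 0 < √(m : ℝ) := Real.sqrt_pos.2 hm0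
    calc 2 * (φ ^ (m - binWt x + l) / √(((m - binWt x : ℕ) : ℝ) + 1))
        ≤ 2 * (φ ^ (m - binWt x + l) / (√(m : ℝ) / 2)) := by gcongr
      _ = _ := by
        rw [pow_add, pow_sub₀ _ hφ.ne' (binWt_le x)]
        field_simp
        norm_num
  refine sum_sum_le_of_fiber_le gammaInd_nonneg binWt binWt Real.one_lt_goldenRatio (by positivity)
    X Y (fun x hx => key Y x (hX x hx)) fun y hy k => ?_
  simp only [fun x => gammaInd_comm x y]
  exact key X y (hY y hy) k

/-- The combinatorial estimate for the discrete Rayleigh norm. -/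
theorem sum_gammaInd_le {m : ℕ} (hm : 1 ≤ m) (X Y : Finset (BinVec m)) :
    ∑ x ∈ X, ∑ y ∈ Y, gammaInd x y ≤
      (8 * (φ / (φ - 1)) + 12) * (φ ^ m / √m * √((X.card : ℝ) * Y.card)) := by
  have hφ := Real.goldenRatio_pos
  have hφ1 : 0 < φ - 1 := sub_pos.2 Real.one_lt_goldenRatio
  -- split off the vertices of large weight on both sides
  set X₁ := X.filter fun x => 3 * (m - binWt x) ≤ m with hX₁
  set X₂ := X.filter fun x => ¬ 3 * (m - binWt x) ≤ m with hX₂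
  set Y₁ := Y.filter fun x => 3 * (m - binWt x) ≤ m with hY₁
  set Y₂ := Y.filter fun x => ¬ 3 * (m - binWt x) ≤ m with hY₂
  have mono {P Q : Finset (BinVec m)} (hP : P ⊆ X) (hQ : Q ⊆ Y) :
      √((P.card : ℝ) * Q.card) ≤ √((X.card : ℝ) * Y.card) := by
    have := Finset.card_le_card hP
    have := Finset.card_le_card hQ
    gcongr
  have h1 := sum_gammaInd_le_of_large hm X₁ Y fun x hx => (Finset.mem_filter.1 hx).2
  have h2 := sum_gammaInd_le_of_large hm Y₁ X₂ fun x hx => (Finset.mem_filter.1 hx).2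
  have h3 := sum_gammaInd_le_of_small hm X₂ Y₂ (fun x hx => not_le.1 (Finset.mem_filter.1 hx).2)
    fun x hx => not_le.1 (Finset.mem_filter.1 hx).2
  have sX₁ : X₁ ⊆ X := Finset.filter_subset _ _
  have sX₂ : X₂ ⊆ X := Finset.filter_subset _ _
  have sY₁ : Y₁ ⊆ Y := Finset.filter_subset _ _
  have sY₂ : Y₂ ⊆ Y := Finset.filter_subset _ _
  rw [Finset.sum_comm] at h2
  simp only [fun x y : BinVec m => gammaInd_comm y x] at h2
  rw [mul_comm (Y₁.card : ℝ)] at h2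
  have h1' := h1.trans (mul_le_mul_of_nonneg_left (mono sX₁ le_rfl) (by positivity))
  have h2' := h2.trans (mul_le_mul_of_nonneg_left (mono sX₂ sY₁) (by positivity))
  have h3' := h3.trans (mul_le_mul_of_nonneg_left (mono sX₂ sY₂) (by positivity))
  have e1 : ∑ x ∈ X, ∑ y ∈ Y, gammaInd x y = ∑ x ∈ X₁, ∑ y ∈ Y, gammaInd x y +
      (∑ x ∈ X₂, ∑ y ∈ Y₁, gammaInd x y + ∑ x ∈ X₂, ∑ y ∈ Y₂, gammaInd x y) := by
    rw [← Finset.sum_add_distrib, ← Finset.sum_filter_add_sum_filter_not X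
      fun x => 3 * (m - binWt x) ≤ m]
    congr 1
    exact Finset.sum_congr rfl fun x _ => (Finset.sum_filter_add_sum_filter_not _ _ _).symm
  rw [e1]
  linarith

/-- The left side counts, for `x` of weight `m - n`, the walks `x, v, y` of length two in `Γ_m`
with `y` of weight `l`, by the weight `j` of `v`. -/
theorem sum_choose_mul_choose_le {m n : ℕ} (hn : n ≤ m) (l : ℕ) :
    ∑ j ∈ Finset.range (n + 1), (n.choose j : ℝ) * (m - j).choose l ≤
      (φ + 1) * (φ ^ (m + n + l) / √(m + 1)) := by
  have hφ := Real.goldenRatio_pos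
  have hi : φ⁻¹ = φ - 1 :=
    inv_eq_of_mul_eq_one_right (by linear_combination Real.goldenRatio_sq)
  have h := sum_choose_mul_div_sqrt_le (a := 1) (b := φ⁻¹) (M := m + 1) one_pos (by positivity)
    (by positivity) n (fun i => ((m - (n - i) : ℕ) : ℝ) + 1) fun i hi => by
      rw [div_le_iff₀ (by positivity), Nat.cast_sub (by omega), Nat.cast_sub hi]
      have h1 : (n : ℝ) ≤ m := by exact_mod_cast hn
      have h2 : (i : ℝ) ≤ n := by exact_mod_cast hi
      nlinarith
  rw [show 1 + φ⁻¹ = φ by rw [hi]; ring] at h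
  calc ∑ j ∈ Finset.range (n + 1), (n.choose j : ℝ) * (m - j).choose l
      ≤ ∑ j ∈ Finset.range (n + 1),
          2 * φ ^ (m + l) * ((n.choose j : ℝ) * φ⁻¹ ^ j / √(((m - j : ℕ) : ℝ) + 1)) := by
        refine Finset.sum_le_sum fun j hj => ?_
        have hj' : j ≤ m := by have := Finset.mem_range.1 hj; omega
        calc (n.choose j : ℝ) * (m - j).choose l
            ≤ n.choose j * (2 * (φ ^ (m - j + l) / √(((m - j : ℕ) : ℝ) + 1))) := by
              gcongr
              exact choose_le_goldenRatio_pow _ l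
          _ = _ := by
            rw [pow_add, pow_add, pow_sub₀ _ hφ.ne' hj', inv_pow]
            ring
    _ = 2 * φ ^ (m + l) * ∑ i ∈ Finset.range (n + 1),
          (n.choose i : ℝ) * 1 ^ i * φ⁻¹ ^ (n - i) / √(((m - (n - i) : ℕ) : ℝ) + 1) := by
        rw [← Finset.mul_sum, ← Finset.sum_range_reflect]
        congr 1
        refine Finset.sum_congr rfl fun i hi => ?_
        rw [Nat.add_sub_cancel, Nat.choose_symm (Nat.lt_succ_iff.1 (Finset.mem_range.1 hi)),
          one_pow, mul_one]
    _ ≤ 2 * φ ^ (m + l) * ((φ / 1 + 1) / 2 * (φ ^ n / √(m + 1))) := by gcongr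
    _ = _ := by rw [pow_add, pow_add, pow_add]; ring

/-- The combinatorial estimate for the discrete norm: `sum_sum_le_of_fiber_le` applied to the
number `K x y` of common neighbours, that is, to the square of the adjacency matrix. -/
theorem sum_sq_sum_gammaInd_le {m : ℕ} (hm : 1 ≤ m) (X : Finset (BinVec m)) :
    ∑ v, (∑ x ∈ X, gammaInd v x) ^ 2 ≤
      (2 * (φ / (φ - 1)) * (φ + 1)) * (φ ^ (2 * m) / √m * X.card) := by
  have hφ := Real.goldenRatio_pos
  have hm0 : (0 : ℝ) < m := by exact_mod_cast hm
  set K : BinVec m → BinVec m → ℝ := fun x y => ∑ v, gammaInd x v * gammaInd v y with hK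
  have hKc (x y) : K x y = K y x := by
    refine Finset.sum_congr rfl fun v _ => ?_
    rw [gammaInd_comm x v, gammaInd_comm v y, mul_comm]
  have e : ∑ v, (∑ x ∈ X, gammaInd v x) ^ 2 = ∑ x ∈ X, ∑ y ∈ X, K x y := by
    simp only [sq, Finset.sum_mul_sum, hK]
    rw [Finset.sum_comm]
    refine Finset.sum_congr rfl fun x _ => ?_
    rw [Finset.sum_comm]
    simp only [fun v => gammaInd_comm v x]
  have key (x : BinVec m) (l : ℕ) : ∑ y ∈ X with binWt y = l, K x y ≤
      (φ + 1) * (φ ^ (2 * m) / √m) * (φ ^ l / φ ^ binWt x) := by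
    calc ∑ y ∈ X with binWt y = l, K x y
        = ∑ v, gammaInd x v * ∑ y ∈ X with binWt y = l, gammaInd v y := by
          simp only [hK, Finset.mul_sum]
          exact Finset.sum_comm
      _ ≤ ∑ v, gammaInd x v * ((m - binWt v).choose l : ℝ) :=
          Finset.sum_le_sum fun v _ => mul_le_mul_of_nonneg_left (sum_fiber_gammaInd_le X v l)
            (gammaInd_nonneg _ _)
      _ ≤ (φ + 1) * (φ ^ (m + (m - binWt x) + l) / √(m + 1)) := by
          rw [sum_gammaInd_mul x fun j => ((m - j).choose l : ℝ)]
          exact sum_choose_mul_choose_le (Nat.sub_le _ _) l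
      _ ≤ (φ + 1) * (φ ^ (m + (m - binWt x) + l) / √m) := by
          gcongr
          linarith
      _ = _ := by
          rw [pow_add, pow_add, pow_sub₀ _ hφ.ne' (binWt_le x), two_mul, pow_add]
          field_simp
  have h := sum_sum_le_of_fiber_le (K := K) (fun x y => Finset.sum_nonneg fun _ _ =>
    mul_nonneg (gammaInd_nonneg _ _) (gammaInd_nonneg _ _)) binWt binWt Real.one_lt_goldenRatio
    (by positivity) X X (fun x _ => key x) fun y _ k => by
      simp only [fun x => hKc x y]
      exact key y k
  rw [Real.sqrt_mul_self (by positivity)] at h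
  rw [e]
  refine h.trans (le_of_eq (by ring))

/-! ### Operator norms -/

theorem eucNorm_sq {n : Type*} [Fintype n] (x : n → ℂ) : eucNorm x ^ 2 = ∑ i, ‖x i‖ ^ 2 :=
  EuclideanSpace.norm_sq_eq _

theorem eucNorm_nonneg {n : Type*} [Fintype n] (x : n → ℂ) : 0 ≤ eucNorm x := norm_nonneg _

theorem eucNorm_mulVec_le {n p : Type*} [Fintype n] [Fintype p] [DecidableEq p]
    (A : Matrix n p ℂ) (x : p → ℂ) : eucNorm (A *ᵥ x) ≤ ‖A‖ * eucNorm x :=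
  A.l2_opNorm_mulVec (WithLp.toLp 2 x)

theorem l2_opNorm_le_of_eucNorm_le {n p : Type*} [Fintype n] [Fintype p] [DecidableEq p]
    (A : Matrix n p ℂ) {c : ℝ} (hc : 0 ≤ c) (h : ∀ x, eucNorm (A *ᵥ x) ≤ c * eucNorm x) :
    ‖A‖ ≤ c := by
  rw [Matrix.l2_opNorm_def]
  exact ContinuousLinearMap.opNorm_le_bound _ hc fun x => h x.ofLp

/-- Schur's test, for a matrix dominated entrywise by a symmetric one. -/
theorem l2_opNorm_le_of_pos_subeigenvector {n : Type*} [Fintype n] [DecidableEq n]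
    (A : Matrix n n ℂ) (a : n → n → ℝ) (ha : ∀ i j, ‖A i j‖ ≤ a i j) (hs : ∀ i j, a i j = a j i)
    {c : ℝ} (hc : 0 ≤ c) (g : n → ℝ) (hg : ∀ i, 0 < g i) (h : ∀ i, ∑ j, a i j * g j ≤ c * g i) :
    ‖A‖ ≤ c := by
  have ha0 (i j) : 0 ≤ a i j := (norm_nonneg _).trans (ha i j)
  refine l2_opNorm_le_of_eucNorm_le A hc fun x => ?_
  refine (pow_le_pow_iff_left₀ (eucNorm_nonneg _) (mul_nonneg hc (eucNorm_nonneg _))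
    two_ne_zero).1 ?_
  rw [mul_pow, eucNorm_sq, eucNorm_sq]
  have row (i : n) : ‖(A *ᵥ x) i‖ ^ 2 ≤ c * ∑ j, g i * (a i j * (‖x j‖ ^ 2 / g j)) := by
    have h1 : ‖(A *ᵥ x) i‖ ≤ ∑ j, a i j * ‖x j‖ := by
      refine (norm_sum_le _ _).trans (Finset.sum_le_sum fun j _ => ?_)
      rw [norm_mul]
      exact mul_le_mul_of_nonneg_right (ha i j) (norm_nonneg _)
    have h2 : (∑ j, a i j * ‖x j‖) ^ 2 ≤ (∑ j, a i j * g j) * ∑ j, a i j * (‖x j‖ ^ 2 / g j) := by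
      refine Finset.sum_sq_le_sum_mul_sum_of_sq_le_mul _
        (fun j _ => mul_nonneg (ha0 i j) (hg j).le)
        (fun j _ => mul_nonneg (ha0 i j) (div_nonneg (sq_nonneg _) (hg j).le)) fun j _ => ?_
      have := (hg j).ne'
      apply le_of_eq
      field_simp
    have h3 : 0 ≤ ∑ j, a i j * (‖x j‖ ^ 2 / g j) :=
      Finset.sum_nonneg fun j _ => mul_nonneg (ha0 i j) (div_nonneg (sq_nonneg _) (hg j).le)
    calc ‖(A *ᵥ x) i‖ ^ 2 ≤ (∑ j, a i j * ‖x j‖) ^ 2 := by gcongr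
      _ ≤ (c * g i) * ∑ j, a i j * (‖x j‖ ^ 2 / g j) :=
          h2.trans (mul_le_mul_of_nonneg_right (h i) h3)
      _ = _ := by rw [← Finset.mul_sum]; ring
  calc ∑ i, ‖(A *ᵥ x) i‖ ^ 2 ≤ ∑ i, c * ∑ j, g i * (a i j * (‖x j‖ ^ 2 / g j)) :=
        Finset.sum_le_sum fun i _ => row i
    _ = c * ∑ j, (∑ i, a j i * g i) * (‖x j‖ ^ 2 / g j) := by
        rw [← Finset.mul_sum, Finset.sum_comm]
        congr 1
        refine Finset.sum_congr rfl fun j _ => ?_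
        rw [Finset.sum_mul]
        exact Finset.sum_congr rfl fun i _ => by rw [hs i j]; ring
    _ ≤ c * ∑ j, (c * g j) * (‖x j‖ ^ 2 / g j) := by
        gcongr with j
        · exact div_nonneg (sq_nonneg _) (hg j).le
        · exact h j
    _ = _ := by
        have hj (j : n) : c * g j * (‖x j‖ ^ 2 / g j) = c * ‖x j‖ ^ 2 := by
          have := (hg j).ne'
          field_simp
        simp only [hj, ← Finset.mul_sum]
        ring

theorem gammaMatrix_apply {m : ℕ} (u v : BinVec m) : gammaMatrix m u v = (gammaInd u v : ℂ) := by
  simp only [gammaMatrix, Matrix.of_apply, gammaInd]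
  split_ifs <;> simp

theorem norm_gammaMatrix (m : ℕ) : ‖gammaMatrix m‖ = φ ^ m := by
  have hφ := Real.goldenRatio_pos
  refine le_antisymm ?_ ?_
  · refine l2_opNorm_le_of_pos_subeigenvector _ gammaInd (fun i j => ?_) gammaInd_comm
      (by positivity) (fun x => φ⁻¹ ^ binWt x) (fun x => by positivity)
      fun x => (sum_gammaInd_mul_inv_pow x).le
    rw [gammaMatrix_apply, Complex.norm_real, Real.norm_of_nonneg (gammaInd_nonneg _ _)]
  · set g : BinVec m → ℂ := fun x => ((φ⁻¹ ^ binWt x : ℝ) : ℂ) with hg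
    have hg0 : g ≠ 0 := fun h => by
      have h0 : ((φ⁻¹ ^ binWt (0 : BinVec m) : ℝ) : ℂ) = 0 := congrFun h 0
      exact (pow_pos (inv_pos.2 hφ) _).ne' (Complex.ofReal_eq_zero.1 h0)
    have h : gammaMatrix m *ᵥ g = ((φ ^ m : ℝ) : ℂ) • g := by
      funext x
      have := congrArg (fun r : ℝ => (r : ℂ)) (sum_gammaInd_mul_inv_pow x)
      simp only [Complex.ofReal_sum, Complex.ofReal_mul] at this
      simp only [Matrix.mulVec, dotProduct, gammaMatrix_apply, hg, Pi.smul_apply, smul_eq_mul]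
      exact this
    have h2 := eucNorm_mulVec_le (gammaMatrix m) g
    have hpos : 0 < eucNorm g := norm_pos_iff.2 (by simpa using hg0)
    have h3 : eucNorm (gammaMatrix m *ᵥ g) = φ ^ m * eucNorm g := by
      rw [h, eucNorm, WithLp.toLp_smul, norm_smul, Complex.norm_real,
        Real.norm_of_nonneg (by positivity)]
      rfl
    rw [h3] at h2
    exact le_of_mul_le_mul_right h2 hpos

/-! ### The discrete norms -/

/-- A binary vector is the indicator of a non-empty set. -/
theorem exists_finset_of_isBinaryVec {n : Type*} [Fintype n] {ξ : n → ℂ} (h : IsBinaryVec ξ) :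
    ∃ X : Finset n, X.Nonempty ∧ eucNorm ξ = √(X.card : ℝ) ∧
      ∀ f : n → ℂ, ∑ i, f i * ξ i = ∑ i ∈ X, f i := by
  classical
  refine ⟨({i | ξ i = 1} : Finset n), ?_, ?_, fun f => ?_⟩
  · obtain ⟨i, hi⟩ := Function.ne_iff.1 h.1
    exact ⟨i, by simpa using (h.2 i).resolve_left hi⟩
  · rw [← Real.sqrt_sq (eucNorm_nonneg ξ), eucNorm_sq, Finset.card_filter, Nat.cast_sum]
    congr 1
    refine Finset.sum_congr rfl fun i _ => ?_
    rcases h.2 i with hi | hi <;> simp [hi]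
  · rw [Finset.sum_filter]
    refine Finset.sum_congr rfl fun i _ => ?_
    rcases h.2 i with hi | hi <;> simp [hi]

theorem norm_sum_le_sum_gammaInd {m : ℕ} {B : Matrix (BinVec m) (BinVec m) ℂ}
    (hB : ∀ u v, ‖B u v‖ ≤ gammaInd u v) (X : Finset (BinVec m)) (v : BinVec m) :
    ‖∑ u ∈ X, B v u‖ ≤ ∑ u ∈ X, gammaInd v u :=
  (norm_sum_le _ _).trans (Finset.sum_le_sum fun _ _ => hB _ _)

/-- Stated for all matrices dominated entrywise by the adjacency matrix of `Γ_m`, so that it also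
covers the graph without the loop. -/
theorem discreteNorm_le {m : ℕ} (hm : 1 ≤ m) {B : Matrix (BinVec m) (BinVec m) ℂ}
    (hB : ∀ u v, ‖B u v‖ ≤ gammaInd u v) :
    discreteNorm B ≤ √(2 * (φ / (φ - 1)) * (φ + 1)) * (φ ^ m / (m : ℝ) ^ (1 / 4 : ℝ)) := by
  have hφ := Real.goldenRatio_pos
  have hφ1 : 0 < φ - 1 := sub_pos.2 Real.one_lt_goldenRatio
  have hm0 : (0 : ℝ) < m := by exact_mod_cast hm
  obtain ⟨ξ, hξ, hr⟩ := (discreteNorm_isGreatest B).1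
  obtain ⟨X, hX, hn, hs⟩ := exists_finset_of_isBinaryVec hξ
  have hc : (0 : ℝ) < X.card := by exact_mod_cast hX.card_pos
  rw [hr, hn, div_le_iff₀ (Real.sqrt_pos.2 hc)]
  refine (pow_le_pow_iff_left₀ (eucNorm_nonneg _) (by positivity) two_ne_zero).1 ?_
  have hq : ((m : ℝ) ^ (1 / 4 : ℝ)) ^ 2 = √(m : ℝ) := by
    rw [← Real.rpow_natCast, ← Real.rpow_mul hm0.le, Real.sqrt_eq_rpow]
    norm_num
  rw [mul_pow, mul_pow, Real.sq_sqrt hc.le, Real.sq_sqrt (by positivity), div_pow, hq, eucNorm_sq]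
  have h := sum_sq_sum_gammaInd_le hm X
  rw [mul_comm 2 m, pow_mul, ← mul_assoc] at h
  refine le_trans (Finset.sum_le_sum fun v _ => ?_) h
  have : (B *ᵥ ξ) v = ∑ u ∈ X, B v u := hs _
  rw [this]
  gcongr
  exact norm_sum_le_sum_gammaInd hB X v

theorem discreteRayleighNorm_le {m : ℕ} (hm : 1 ≤ m) {B : Matrix (BinVec m) (BinVec m) ℂ}
    (hB : ∀ u v, ‖B u v‖ ≤ gammaInd u v) :
    discreteRayleighNorm B ≤ (8 * (φ / (φ - 1)) + 12) * (φ ^ m / √(m : ℝ)) := by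
  obtain ⟨ξ, η, hξ, hη, hr⟩ := (discreteRayleighNorm_isGreatest B).1
  obtain ⟨X, hX, hnX, hsX⟩ := exists_finset_of_isBinaryVec hξ
  obtain ⟨Y, hY, hnY, hsY⟩ := exists_finset_of_isBinaryVec hη
  have hcX : (0 : ℝ) < X.card := by exact_mod_cast hX.card_pos
  have hcY : (0 : ℝ) < Y.card := by exact_mod_cast hY.card_pos
  rw [hr, hnX, hnY, div_le_iff₀ (mul_pos (Real.sqrt_pos.2 hcX) (Real.sqrt_pos.2 hcY)),
    ← Real.sqrt_mul hcX.le, mul_assoc]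
  refine le_trans ?_ (sum_gammaInd_le hm X Y)
  have h1 : ξ ⬝ᵥ (B *ᵥ η) = ∑ x ∈ X, ∑ y ∈ Y, B x y := by
    rw [dotProduct_comm]
    refine (hsX _).trans (Finset.sum_congr rfl fun x _ => hsY _)
  rw [h1]
  exact (norm_sum_le _ _).trans (Finset.sum_le_sum fun x _ => norm_sum_le_sum_gammaInd hB Y x)

theorem card_gammaNbrs {m : ℕ} (X : Finset (BinVec m)) (v : BinVec m) :
    ((gammaNbrs X v).card : ℝ) = ∑ u ∈ X, gammaInd v u := by
  simp only [gammaInd_comm v]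
  simp [gammaNbrs, gammaInd]

theorem gammaEdges_eq {m : ℕ} (X Y : Finset (BinVec m)) :
    (gammaEdges X Y : ℝ) = ∑ x ∈ X, ∑ y ∈ Y, gammaInd x y := by
  rw [← Finset.sum_product']
  simp [gammaEdges, gammaInd]

/-! ### Removing the loop -/

/-- `Γ_m` with the loop at the zero vector removed, as a simple graph. -/
def gammaGraph (m : ℕ) : SimpleGraph (BinVec m) where
  Adj u v := u ≠ v ∧ GammaAdj m u v
  symm := ⟨fun _ _ h => ⟨h.1.symm, gammaAdj_comm.1 h.2⟩⟩
  loopless := ⟨fun _ h => h.1 rfl⟩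

theorem gammaAdj_zero {m : ℕ} (v : BinVec m) : GammaAdj m 0 v := by
  simp [GammaAdj]

theorem eq_zero_of_gammaAdj_self {m : ℕ} {v : BinVec m} (h : GammaAdj m v v) : v = 0 := by
  simpa [GammaAdj] using h

theorem gammaGraph_ne_bot {m : ℕ} (hm : 1 ≤ m) : gammaGraph m ≠ ⊥ := by
  intro h
  have hne : (0 : BinVec m) ≠ 1 := fun h0 => by simpa using congrFun h0 ⟨0, hm⟩
  have h1 : (gammaGraph m).Adj 0 1 := ⟨hne, gammaAdj_zero _⟩
  rw [h] at h1
  exact h1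

theorem norm_adjMatrix_gammaGraph_apply_le (m : ℕ) [DecidableRel (gammaGraph m).Adj]
    (u v : BinVec m) : ‖(gammaGraph m).adjMatrix ℂ u v‖ ≤ gammaInd u v := by
  rw [SimpleGraph.adjMatrix_apply]
  split_ifs with h
  · simp [gammaInd, h.2]
  · simpa using gammaInd_nonneg u v

/-- Removing the loop changes the operator norm by at most `1`, and `1 ≤ (1 - 1 / 4) * φ ^ m`. -/
theorem norm_adjMatrix_gammaGraph_ge {m : ℕ} (hm : 1 ≤ m) [DecidableRel (gammaGraph m).Adj] :
    φ ^ m / 4 ≤ ‖(gammaGraph m).adjMatrix ℂ‖ := by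
  have hd : gammaMatrix m =
      (gammaGraph m).adjMatrix ℂ + Matrix.diagonal (Pi.single (0 : BinVec m) (1 : ℂ)) := by
    ext u v
    rw [Matrix.add_apply, SimpleGraph.adjMatrix_apply, gammaMatrix_apply]
    by_cases huv : u = v
    · subst huv
      by_cases hu : u = 0
      · subst hu
        simp [gammaInd, gammaAdj_zero]
      · have : ¬ GammaAdj m u u := fun h => hu (eq_zero_of_gammaAdj_self h)
        simp [gammaInd, hu, this]
    · by_cases h : GammaAdj m u v <;> simp [gammaInd, gammaGraph, huv, h]
  have h1 : φ ^ m ≤ ‖(gammaGraph m).adjMatrix ℂ‖ + 1 := by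
    rw [← norm_gammaMatrix, hd]
    refine (norm_add_le _ _).trans ?_
    rw [Matrix.l2_opNorm_diagonal, Pi.norm_single, norm_one]
  have h2 : 1.6 ≤ φ ^ m :=
    goldenRatio_gt.le.trans (le_self_pow₀ Real.one_lt_goldenRatio.le (by omega))
  linarith

/-- Any quantity `N` that is `O(φ ^ m / m ^ s)` on the loopless graphs is eventually smaller than
any given multiple of the operator norm. -/
theorem exists_lt_mul_norm_adjMatrix {N : ∀ {m : ℕ}, Matrix (BinVec m) (BinVec m) ℂ → ℝ}
    {C s : ℝ} (hs : 0 < s)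
    (hN : ∀ (m : ℕ), 1 ≤ m → ∀ [DecidableRel (gammaGraph m).Adj],
      N ((gammaGraph m).adjMatrix ℂ) ≤ C * (φ ^ m / (m : ℝ) ^ s)) {c : ℝ} (hc : 0 < c) :
    ∃ m : ℕ, 1 ≤ m ∧ ∀ [DecidableRel (gammaGraph m).Adj],
      N ((gammaGraph m).adjMatrix ℂ) < c * ‖(gammaGraph m).adjMatrix ℂ‖ := by
  have hlim : Filter.Tendsto (fun m : ℕ => (m : ℝ) ^ s) Filter.atTop Filter.atTop :=
    (tendsto_rpow_atTop hs).comp tendsto_natCast_atTop_atTop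
  obtain ⟨m, hm, hm1⟩ :=
    ((hlim.eventually_gt_atTop (4 * C / c)).and (Filter.eventually_ge_atTop 1)).exists
  have hm0 : (0 : ℝ) < m := by exact_mod_cast hm1
  have hφ : 0 < φ ^ m := pow_pos Real.goldenRatio_pos m
  have hp : 0 < (m : ℝ) ^ s := Real.rpow_pos_of_pos hm0 s
  refine ⟨m, hm1, ?_⟩
  intro _
  refine (hN m hm1).trans_lt (lt_of_lt_of_le ?_
    (mul_le_mul_of_nonneg_left (norm_adjMatrix_gammaGraph_ge hm1) hc.le))
  rw [← mul_div_assoc, div_lt_iff₀ hp]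
  rw [div_lt_iff₀ hc] at hm
  nlinarith

theorem theorem5 :
    -- the `L²` operator norm of `A_m`
    (∀ m : ℕ, 1 ≤ m → ‖gammaMatrix m‖ = φ ^ m) ∧
    -- the discrete norm and the discrete Rayleigh norm of `A_m`
    (∃ C : ℝ, 0 < C ∧ ∀ m : ℕ, 1 ≤ m →
      discreteNorm (gammaMatrix m) ≤ C * (‖gammaMatrix m‖ / (m : ℝ) ^ (1 / 4 : ℝ))) ∧
    (∃ C : ℝ, 0 < C ∧ ∀ m : ℕ, 1 ≤ m →
      discreteRayleighNorm (gammaMatrix m) ≤ C * (‖gammaMatrix m‖ / √(m : ℝ))) ∧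
    -- the combinatorial forms of the two estimates
    (∃ C : ℝ, 0 < C ∧ ∀ m : ℕ, 1 ≤ m → ∀ X : Finset (BinVec m),
      ∑ v : BinVec m, ((gammaNbrs X v).card : ℝ) ^ 2
        ≤ C * (φ ^ (2 * m) / √(m : ℝ) * (X.card : ℝ))) ∧
    (∃ C : ℝ, 0 < C ∧ ∀ m : ℕ, 1 ≤ m → ∀ X Y : Finset (BinVec m),
      (gammaEdges X Y : ℝ)
        ≤ C * (φ ^ m / √(m : ℝ) * √((X.card : ℝ) * (Y.card : ℝ)))) ∧
    -- no bound without a logarithmic factor holds for all non-zero symmetric 0-1 matrices with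
    -- zero diagonal, that is, for the adjacency matrices of all simple graphs with an edge
    (¬ ∃ c : ℝ, 0 < c ∧ ∀ (V : Type) [Fintype V] [DecidableEq V] (G : SimpleGraph V)
      [DecidableRel G.Adj], G ≠ ⊥ → c * ‖G.adjMatrix ℂ‖ ≤ discreteNorm (G.adjMatrix ℂ)) ∧
    (¬ ∃ c : ℝ, 0 < c ∧ ∀ (V : Type) [Fintype V] [DecidableEq V] (G : SimpleGraph V)
      [DecidableRel G.Adj], G ≠ ⊥ → c * ‖G.adjMatrix ℂ‖ ≤ discreteRayleighNorm (G.adjMatrix ℂ)) := by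
  classical
  have hφ := Real.goldenRatio_pos
  have hφ1 : 0 < φ - 1 := sub_pos.2 Real.one_lt_goldenRatio
  have hB (m : ℕ) (u v : BinVec m) : ‖gammaMatrix m u v‖ ≤ gammaInd u v := by
    rw [gammaMatrix_apply, Complex.norm_real, Real.norm_of_nonneg (gammaInd_nonneg _ _)]
  have hΔ : 0 < 2 * (φ / (φ - 1)) * (φ + 1) := by positivity
  have hP : 0 < 8 * (φ / (φ - 1)) + 12 := by positivity
  refine ⟨fun m _ => norm_gammaMatrix m, ⟨_, Real.sqrt_pos.2 hΔ, fun m hm => ?_⟩,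
    ⟨_, hP, fun m hm => ?_⟩, ⟨_, hΔ, fun m hm X => ?_⟩, ⟨_, hP, fun m hm X Y => ?_⟩, ?_, ?_⟩
  · rw [norm_gammaMatrix]
    exact discreteNorm_le hm (hB m)
  · rw [norm_gammaMatrix]
    exact discreteRayleighNorm_le hm (hB m)
  · simp only [card_gammaNbrs]
    exact sum_sq_sum_gammaInd_le hm X
  · rw [gammaEdges_eq]
    exact sum_gammaInd_le hm X Y
  · rintro ⟨c, hc, h⟩
    obtain ⟨m, hm, hlt⟩ := exists_lt_mul_norm_adjMatrix (N := discreteNorm)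
      (show (0 : ℝ) < 1 / 4 by norm_num)
      (fun m hm _ => discreteNorm_le hm (norm_adjMatrix_gammaGraph_apply_le m)) hc
    exact absurd (h _ (gammaGraph m) (gammaGraph_ne_bot hm)) (not_le.2 hlt)
  · rintro ⟨c, hc, h⟩
    obtain ⟨m, hm, hlt⟩ := exists_lt_mul_norm_adjMatrix (N := discreteRayleighNorm)
      (show (0 : ℝ) < 1 / 2 by norm_num)
      (fun m hm _ => by
        rw [← Real.sqrt_eq_rpow]
        exact discreteRayleighNorm_le hm (norm_adjMatrix_gammaGraph_apply_le m)) hc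
    exact absurd (h _ (gammaGraph m) (gammaGraph_ne_bot hm)) (not_le.2 hlt)
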